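/- Let $(X,\mu)$ be a standard probability space, that is, a standard Borel space with a non-atomic Borel probability measure. Let $\mathrm{Aut}(X,\mu)$ be the group of measure-preserving Borel bijections of $X$, identified when they agree $\mu$-almost everywhere, with the Borel structure of the weak topology, i.e. the coarsest topology for which $T\mapsto T(A)$ is continuous into the measure algebra (with the metric $d(A,B)=\mu(A\mathbin{\triangle} B)$) for every measurable $A\subseteq X$. Let $G$ be a Polish group acting on $X$ by measure-preserving transformations in a Borel way (the map $G\times X\to X$ is Borel). Suppose that the action is essentially free: there is a $G$-invariant set $A\subseteq X$ of full measure such that $gx\neq x$ for all $g\in G\setminus\{1_G\}$ and all $x\in A$. Let $H\leq G$ be an arbitrary subgroup. Let $[H]_D$ be the smallest subgroup of $\mathrm{Aut}(X,\mu)$ that contains the image of $H$ and is full. Here a subgroup $\mathbb G$ of $\mathrm{Aut}(X,\mu)$ is full if $T\in\mathbb G$ whenever $T\in\mathrm{Aut}(X,\mu)$ and there are a measurable partition $(A_n)_{n\in\mathbb N}$ of $X$ and elements $T_n\in\mathbb G$ such that $T$ agrees with $T_n$ almost everywhere on $A_n$ for every $n$. Let $[\mathcal R_H]$ be the subgroup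 of $\mathrm{Aut}(X,\mu)$ of the classes of those measure-preserving Borel bijections $T$ with $T(x)\in H\cdot x$ for all $x\in X$. Then the following are equivalent: 1. $H$ is a Borel subgroup of $G$; 2. $[H]_D$ is a Borel subgroup of $\mathrm{Aut}(X,\mu)$; 3. $[\mathcal R_H]$ is a Borel subgroup of $\mathrm{Aut}(X,\mu)$. -/

import Mathlib

open MeasureTheory Filter Topology
open scoped symmDiff

noncomputable section

namespace FullGroups

section Aut

variable {X : Type*} [MeasurableSpace X]

/-- The group of measure-preserving Borel bijections of `(X, μ)`, before identification. -/
def mpBij (μ : Measure X) : Subgroup (Equiv.Perm X) where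
  carrier := {T | MeasurePreserving T μ μ ∧ MeasurePreserving (T⁻¹ : Equiv.Perm X) μ μ}
  one_mem' := ⟨MeasurePreserving.id μ, MeasurePreserving.id μ⟩
  mul_mem' := by
    rintro S T ⟨hS, hS'⟩ ⟨hT, hT'⟩
    refine ⟨hS.comp hT, ?_⟩
    rw [mul_inv_rev]
    exact hT'.comp hS'
  inv_mem' := by
    rintro T ⟨hT, hT'⟩
    exact ⟨hT', by simpa using hT⟩

/-- The measure-preserving Borel bijections that are almost everywhere the identity. -/
def nullBij (μ : Measure X) : Subgroup (mpBij μ) where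
  carrier := {T | ∀ᵐ x ∂μ, (T : Equiv.Perm X) x = x}
  one_mem' := by simp
  mul_mem' := by
    intro S T hS hT
    filter_upwards [show ∀ᵐ x ∂μ, (S : Equiv.Perm X) x = x from hS,
      show ∀ᵐ x ∂μ, (T : Equiv.Perm X) x = x from hT] with x h1 h2
    simp [h1, h2]
  inv_mem' := by
    intro T hT
    filter_upwards [show ∀ᵐ x ∂μ, (T : Equiv.Perm X) x = x from hT] with x h
    simp only [InvMemClass.coe_inv]
    rw [Equiv.Perm.inv_eq_iff_eq]
    exact h.symm

instance (μ : Measure X) : (nullBij μ).Normal where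
  conj_mem := by
    intro T hT S
    have h : ∀ᵐ x ∂μ, (T : Equiv.Perm X) x = x := hT
    filter_upwards [S.2.2.quasiMeasurePreserving.ae h] with x hx
    simp only [Subgroup.coe_mul, InvMemClass.coe_inv, Equiv.Perm.mul_apply]
    rw [hx]
    simp

/-- `Aut(X, μ)`: measure-preserving Borel bijections of `(X, μ)`, identified up to measure zero. -/
def Aut (μ : Measure X) : Type _ := mpBij μ ⧸ nullBij μ

variable {μ : Measure X}

instance : Group (Aut μ) := inferInstanceAs (Group (mpBij μ ⧸ nullBij μ))

/-- The class of a measure-preserving Borel bijection. -/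
def Aut.mk (μ : Measure X) : mpBij μ →* Aut μ := QuotientGroup.mk' (nullBij μ)

theorem Aut.mk_eq_mk_iff {S T : mpBij μ} :
    Aut.mk μ S = Aut.mk μ T ↔ ∀ᵐ x ∂μ, (S : Equiv.Perm X) x = (T : Equiv.Perm X) x := by
  have h1 : Aut.mk μ S = Aut.mk μ T ↔ S⁻¹ * T ∈ nullBij μ := QuotientGroup.eq
  have h2 : S⁻¹ * T ∈ nullBij μ ↔
      ∀ᵐ x ∂μ, ((S⁻¹ * T : mpBij μ) : Equiv.Perm X) x = x := Iff.rfl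
  rw [h1, h2]
  refine eventually_congr (Eventually.of_forall fun x => ?_)
  simp only [Subgroup.coe_mul, InvMemClass.coe_inv, Equiv.Perm.mul_apply]
  rw [Equiv.Perm.inv_eq_iff_eq, eq_comm]

/-- A representative of `T`. The notions below do not depend on its choice. -/
def Aut.rep (T : Aut μ) : mpBij μ := Quotient.out T

theorem Aut.mk_rep (T : Aut μ) : Aut.mk μ T.rep = T := Quotient.out_eq T

/-- The image `T(A)` of a measurable set `A`, in the space of measurable sets
with the pseudometric `d(A, B) = μ(A ∆ B)`. -/
def mpBij.image (T : mpBij μ) (A : MeasuredSets μ) : MeasuredSets μ :=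
  ⟨(T : Equiv.Perm X) '' (A : Set X), by
    rw [Equiv.image_eq_preimage_symm]
    exact T.2.2.measurable A.2⟩

/-- The weak topology on `Aut(X, μ)`: the coarsest topology making `T ↦ T(A)` continuous into the
measure algebra, for every measurable set `A`. -/
instance : TopologicalSpace (Aut μ) :=
  ⨅ A : MeasuredSets μ, TopologicalSpace.induced (fun T : Aut μ => mpBij.image T.rep A) inferInstance

/-- Convergence in the weak topology means `μ (T_n(A) ∆ T(A)) → 0` for every measurable `A`. -/
theorem Aut.tendsto_iff {ι : Type*} {l : Filter ι} {t : ι → Aut μ} {T : Aut μ} :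
    Tendsto t l (𝓝 T) ↔ ∀ A : Set X, MeasurableSet A →
      Tendsto (fun i => μ ((((t i).rep : Equiv.Perm X) '' A) ∆ ((T.rep : Equiv.Perm X) '' A)))
        l (𝓝 0) := by
  rw [nhds_iInf, tendsto_iInf]
  simp only [nhds_induced, tendsto_comap_iff]
  constructor
  · intro h A hA
    exact tendsto_iff_edist_tendsto_0.1 (h ⟨A, hA⟩)
  · intro h A
    exact tendsto_iff_edist_tendsto_0.2 (h A A.2)

/-- `Aut(X, μ)` carries the Borel structure of its weak topology. -/
instance : MeasurableSpace (Aut μ) := borel (Aut μ)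

instance : BorelSpace (Aut μ) := ⟨rfl⟩

/-- `T` is obtained by cutting and pasting the sequence `t` along some partition of `X`. -/
def CutPaste (t : ℕ → Aut μ) (T : Aut μ) : Prop :=
  ∃ A : ℕ → Set X, (∀ n, MeasurableSet (A n)) ∧ Pairwise (fun m n => Disjoint (A m) (A n)) ∧
    (⋃ n, A n) = Set.univ ∧
    ∀ n, ∀ᵐ x ∂μ, x ∈ A n → (T.rep : Equiv.Perm X) x = ((t n).rep : Equiv.Perm X) x

/-- A subgroup of `Aut(X, μ)` is a full group if it is stable under cutting and pasting. -/
def IsFull (K : Subgroup (Aut μ)) : Prop :=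
  ∀ (t : ℕ → Aut μ) (T : Aut μ), (∀ n, t n ∈ K) → CutPaste t T → T ∈ K

/-- The full group `[Γ]_D` generated by `Γ`: the smallest full group that contains `Γ`. -/
def dyeFullGroup (Γ : Subgroup (Aut μ)) : Subgroup (Aut μ) :=
  sInf {K | IsFull K ∧ Γ ≤ K}

theorem isLeast_dyeFullGroup (Γ : Subgroup (Aut μ)) :
    IsLeast {K | IsFull K ∧ Γ ≤ K} (dyeFullGroup Γ) := by
  refine ⟨⟨fun t T ht hT => ?_, le_sInf fun K hK => hK.2⟩, fun K hK => sInf_le hK⟩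
  refine Subgroup.mem_sInf.2 fun K hK => hK.1 t T (fun n => ?_) hT
  exact Subgroup.mem_sInf.1 (ht n) K hK

/-- The full group `[R]` of an equivalence relation `R` on `X`: the classes of all
measure-preserving Borel bijections `T` such that `(x, T x) ∈ R` for all `x`. -/
def fullGroupOfRel (μ : Measure X) (R : Setoid X) : Subgroup (Aut μ) :=
  Subgroup.map (Aut.mk μ)
    { carrier := {T : mpBij μ | ∀ x, R x ((T : Equiv.Perm X) x)}
      one_mem' := fun x => R.refl x
      mul_mem' := fun {_ T} hS hT x => R.trans (hT x) (hS ((T : Equiv.Perm X) x))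
      inv_mem' := fun {T} hT x => R.symm (by
        simpa using hT ((T : Equiv.Perm X)⁻¹ x)) }

end Aut

section Action

variable {G X : Type*} [Group G] [MeasurableSpace X] [MulAction G X]

/-- The action is essentially free: it is free on an invariant set of full measure. -/
def EssentiallyFree (G : Type*) {X : Type*} [Group G] [MeasurableSpace X] [MulAction G X]
    (μ : Measure X) : Prop :=
  ∃ A : Set X, μ Aᶜ = 0 ∧ (∀ g : G, ∀ x ∈ A, g • x ∈ A) ∧
    ∀ g : G, g ≠ 1 → ∀ x ∈ A, g • x ≠ x

/-- The homomorphism from `G` to `Aut(X, μ)` given by a measure-preserving action. -/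
def actionHom (G : Type*) {X : Type*} [Group G] [MeasurableSpace X] [MulAction G X]
    (μ : Measure X) [MeasurableConstSMul G X] [SMulInvariantMeasure G X μ] : G →* Aut μ :=
  (Aut.mk μ).comp
    ((MulAction.toPermHom G X).codRestrict (mpBij μ) fun g =>
      ⟨measurePreserving_smul g μ, by
        rw [← map_inv]
        exact measurePreserving_smul g⁻¹ μ⟩)

/-- `[H]_D`, where `H` is viewed as a group of measure-preserving transformations. -/
def dyeFullGroupOf (μ : Measure X) [MeasurableConstSMul G X] [SMulInvariantMeasure G X μ]
    (H : Subgroup G) : Subgroup (Aut μ) :=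
  dyeFullGroup (H.map (actionHom G μ))

/-- `[R_H]`, the full group of the orbit equivalence relation of `H` on `X`. -/
def orbitFullGroup (μ : Measure X) (H : Subgroup G) : Subgroup (Aut μ) :=
  fullGroupOfRel μ (MulAction.orbitRel H X)

end Action

end FullGroups

end

/-! By freeness, an element of either full group is the same thing as its cocycle: a measurable `c :
X → G` with values in `H` and `T x = c x • x` almost everywhere. The Dye group consists of the `T`
whose cocycle takes countably many values up to a null set (`dyeFullGroupOf_eq_pieceGroup`), while
the orbit full group allows every `H`-valued cocycle.

If `H` is Borel, a bounded Borel embedding of `G` into `ℝ` turns cocycles into points of the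
standard Borel space `L¹(μ)`. Coding an `H`-valued measure-preserving bijection is a Borel condition
there, and so is being countably valued (`measurableSet_countablyValued`). Decoding is Borel, and
injective by freeness, so by Lusin–Souslin both full groups are Borel (`measurableSet_of_codes`).

Conversely, `G → Aut(X, μ)` is Borel, and by freeness `H` is the preimage of any subgroup lying
between the two full groups. -/

namespace FullGroups

/-! ### Separability of the measure algebra. -/

section MeasureAlgebra

variable {X : Type*} [MeasurableSpace X] {μ : Measure X}

/-- A sequence of sets enumerating a generating `π`-system that is dense in the measure algebra. -/
structure IsDenseSeq (μ : Measure X) (D : ℕ → Set X) : Prop where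
  measurableSet : ∀ n, MeasurableSet (D n)
  generateFrom_eq : MeasurableSpace.generateFrom (Set.range D) = ‹MeasurableSpace X›
  isPiSystem : IsPiSystem (Set.range D)
  exists_lt : ∀ A, MeasurableSet A → ∀ ε : ENNReal, 0 < ε → ∃ n, μ (A ∆ D n) < ε

/-- The set algebra generated by a countable generating family is still countable, and it
approximates every measurable set in measure. -/
theorem exists_isDenseSeq [MeasurableSpace.CountablyGenerated X] (μ : Measure X)
    [IsFiniteMeasure μ] : ∃ D : ℕ → Set X, IsDenseSeq μ D := by
  let C := generateSetAlgebra (MeasurableSpace.countableGeneratingSet X)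
  have hC : IsSetAlgebra C := isSetAlgebra_generateSetAlgebra
  have hgen : MeasurableSpace.generateFrom C = ‹MeasurableSpace X› := by
    rw [generateFrom_generateSetAlgebra_eq, MeasurableSpace.generateFrom_countableGeneratingSet]
  obtain ⟨D, hD⟩ := (countable_generateSetAlgebra
    (MeasurableSpace.countable_countableGeneratingSet (α := X))).exists_eq_range
      ⟨∅, hC.empty_mem⟩
  refine ⟨D, fun n => ?_, by rw [← hD]; exact hgen, ?_, fun A hA ε hε => ?_⟩
  · rw [← hgen]
    exact MeasurableSpace.measurableSet_generateFrom (hD.symm.subset (Set.mem_range_self n))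
  · rw [← hD]
    exact hC.isSetRing.isSetSemiring.isPiSystem
  · obtain ⟨t, htC, ht⟩ := exists_measure_symmDiff_lt_of_generateFrom_isSetRing (μ := μ)
      hC.isSetRing ⟨{Set.univ}, Set.countable_singleton _, by simpa using hC.univ_mem, by simp⟩
      hgen.symm hA hε
    obtain ⟨n, rfl⟩ : t ∈ Set.range D := hD.subset htC
    exact ⟨n, by rwa [symmDiff_comm]⟩

theorem IsDenseSeq.eq_of_forall [MeasurableSpace.SeparatesPoints X] {D : ℕ → Set X}
    (hD : IsDenseSeq μ D) {x y : X} (h : ∀ n, x ∈ D n ↔ y ∈ D n) : x = y := by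
  have hs : @MeasurableSpace.SeparatesPoints X (MeasurableSpace.generateFrom (Set.range D)) := by
    rw [hD.generateFrom_eq]; infer_instance
  exact MeasurableSpace.separating_of_generateFrom (Set.range D) x y (by simpa using h)

instance [MeasurableSpace.CountablyGenerated X] [IsFiniteMeasure μ] :
    SecondCountableTopology (MeasuredSets μ) := by
  obtain ⟨D, hD⟩ := exists_isDenseSeq μ
  have : TopologicalSpace.SeparableSpace (MeasuredSets μ) := by
    refine ⟨Set.range fun n => (⟨D n, hD.measurableSet n⟩ : MeasuredSets μ),
      Set.countable_range _, fun A => EMetric.mem_closure_iff.2 fun ε hε => ?_⟩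
    obtain ⟨n, hn⟩ := hD.exists_lt A A.2 ε hε
    exact ⟨_, ⟨n, rfl⟩, hn⟩
  exact UniformSpace.secondCountable_of_separable _

end MeasureAlgebra

/-! ### The weak topology of `Aut(X, μ)` and its Borel structure. -/

section BorelAut

variable {X : Type*} [MeasurableSpace X] {μ : Measure X}

theorem mpBij.edist_image (T : mpBij μ) (A B : MeasuredSets μ) :
    edist (mpBij.image T A) (mpBij.image T B) = edist A B := by
  change μ (((T : Equiv.Perm X) '' (A : Set X)) ∆ ((T : Equiv.Perm X) '' (B : Set X))) =
    μ ((A : Set X) ∆ (B : Set X))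
  rw [← Set.image_symmDiff (T : Equiv.Perm X).injective, Equiv.image_eq_preimage_symm]
  exact T.2.2.measure_preimage (A.2.symmDiff B.2).nullMeasurableSet

/-- The sequence of images of the sets `D n`. -/
noncomputable def imageSeq {D : ℕ → Set X} (hD : IsDenseSeq μ D) (T : Aut μ) (n : ℕ) : MeasuredSets μ :=
  mpBij.image T.rep ⟨D n, hD.measurableSet n⟩

/-- Each `T` acts isometrically on the measure algebra, so approximating `A` by sets `D n`
approximates `T(A)` uniformly in `T`. Hence `T ↦ T(A)` is a uniform limit of maps continuous for the
topology induced by the images of the `D n` alone. -/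
theorem isInducing_imageSeq {D : ℕ → Set X} (hD : IsDenseSeq μ D) :
    IsInducing (imageSeq hD) := by
  refine ⟨le_antisymm ?_ ?_⟩
  · rw [← continuous_iff_le_induced]
    refine continuous_pi fun n => ?_
    exact continuous_iff_le_induced.2 (iInf_le _ _)
  · refine le_iInf fun A => ?_
    rw [← continuous_iff_le_induced]
    let _ : TopologicalSpace (Aut μ) := TopologicalSpace.induced (imageSeq hD) inferInstance
    have hc : Continuous (imageSeq hD) := continuous_induced_dom
    have h : ∀ k : ℕ, ∃ n, edist A ⟨D n, hD.measurableSet n⟩ < ((k : ENNReal) + 1)⁻¹ :=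
      fun k => hD.exists_lt A A.2 _ (by simp)
    choose n hn using h
    have hlim : TendstoUniformly (fun (k : ℕ) T => imageSeq hD T (n k))
        (fun T : Aut μ => mpBij.image T.rep A) atTop := by
      rw [EMetric.tendstoUniformly_iff]
      intro ε hε
      have h0 : Tendsto (fun k : ℕ => ((k : ENNReal) + 1)⁻¹) atTop (𝓝 0) := by
        have := (tendsto_add_atTop_iff_nat 1).2 ENNReal.tendsto_inv_nat_nhds_zero
        simpa using this
      filter_upwards [h0.eventually_lt_const hε] with k hk T
      exact (mpBij.edist_image _ _ _).trans_lt ((hn k).trans hk)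
    exact hlim.continuous (Frequently.of_forall fun k => (continuous_apply (n k)).comp hc)

variable [MeasurableSpace.CountablyGenerated X] [IsFiniteMeasure μ]

instance : SecondCountableTopology (Aut μ) :=
  (isInducing_imageSeq (exists_isDenseSeq μ).choose_spec).secondCountableTopology

/-- With second countability this makes the Borel structure countably separated, which is all that
Lusin–Souslin asks of the target; Polishness of `Aut μ` is not needed. -/
instance [MeasurableSpace.SeparatesPoints X] : T0Space (Aut μ) := by
  obtain ⟨D, hD⟩ := exists_isDenseSeq μ
  refine ⟨fun S T h => ?_⟩
  have h1 : ∀ n, ∀ᵐ x ∂μ, (x ∈ ((S.rep : Equiv.Perm X) '' D n) ↔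
      x ∈ ((T.rep : Equiv.Perm X) '' D n)) := fun n => by
    have h2 := EMetric.inseparable_iff.1
      ((h.map (isInducing_imageSeq hD).continuous).map (continuous_apply n))
    exact (measure_symmDiff_eq_zero_iff.1 h2).mem_iff
  -- Images under `S` are preimages under `S⁻¹`, so the hypothesis says that no `D n` separates `S⁻¹
  -- x` from `T⁻¹ x`.
  have h3 : Aut.mk μ S.rep⁻¹ = Aut.mk μ T.rep⁻¹ := by
    rw [Aut.mk_eq_mk_iff]
    filter_upwards [ae_all_iff.2 h1] with x hx
    refine hD.eq_of_forall fun n => ?_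
    have := hx n
    rw [Equiv.image_eq_preimage_symm, Equiv.image_eq_preimage_symm] at this
    exact this
  rw [map_inv, map_inv, inv_inj, Aut.mk_rep, Aut.mk_rep] at h3
  exact h3

theorem measurable_measuredSets {Ω : Type*} [MeasurableSpace Ω] {f : Ω → MeasuredSets μ}
    (hf : ∀ A, Measurable fun ω => edist (f ω) A) : @Measurable _ _ _ (borel _) f := by
  let _ : MeasurableSpace (MeasuredSets μ) := borel _
  have _ : BorelSpace (MeasuredSets μ) := ⟨rfl⟩
  refine measurable_of_isOpen fun U hU => ?_
  have h : ∀ a : U, ∃ ε > 0, Metric.eball (a : MeasuredSets μ) ε ⊆ U :=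
    fun a => EMetric.isOpen_iff.1 hU a a.2
  choose ε hε hεU using h
  obtain ⟨C, hC, hCU⟩ := TopologicalSpace.isOpen_iUnion_countable
    (fun a : U => Metric.eball (a : MeasuredSets μ) (ε a)) fun a => Metric.isOpen_eball
  have hU' : U = ⋃ a ∈ C, Metric.eball (a : MeasuredSets μ) (ε a) := by
    rw [hCU]
    refine Set.Subset.antisymm (fun a ha => ?_) (Set.iUnion_subset hεU)
    exact Set.mem_iUnion.2 ⟨⟨a, ha⟩, Metric.mem_eball_self (hε _)⟩
  rw [hU', Set.preimage_iUnion₂]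
  exact MeasurableSet.biUnion hC fun a _ => measurableSet_lt (hf a) measurable_const

theorem measurable_aut {Ω : Type*} [MeasurableSpace Ω] {f : Ω → Aut μ}
    (hf : ∀ A B, MeasurableSet A → MeasurableSet B →
      Measurable fun ω => μ ((((f ω).rep : Equiv.Perm X) '' A) ∆ B)) : Measurable f := by
  obtain ⟨D, hD⟩ := exists_isDenseSeq μ
  let _ : MeasurableSpace (MeasuredSets μ) := borel _
  have _ : BorelSpace (MeasuredSets μ) := ⟨rfl⟩
  have h1 : Measurable fun ω => imageSeq hD (f ω) :=
    measurable_pi_iff.2 fun n => measurable_measuredSets fun B =>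
      hf (D n) B (hD.measurableSet n) B.2
  have h2 : borel (Aut μ) = MeasurableSpace.comap (imageSeq hD) inferInstance := by
    rw [(isInducing_imageSeq hD).eq_induced, borel_comap, ← BorelSpace.measurable_eq]
  change @Measurable _ _ _ (borel (Aut μ)) f
  rw [h2]
  exact measurable_comap_iff.2 h1

end BorelAut

/-! ### From almost everywhere injective maps to bijections. -/

section Extension

variable {X : Type*} [MeasurableSpace X] {μ : Measure X}

/-- Points whose first `n` backward and forward iterates stay in `C`. -/
def iterCore (T : X → X) (C : Set X) : ℕ → Set X
  | 0 => C
  | n + 1 => iterCore T C n ∩ (T '' iterCore T C n ∩ T ⁻¹' iterCore T C n)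

/-- A measure-preserving map that is injective on a conull Borel set agrees almost everywhere with
a measure-preserving bijection, which can be taken to be the identity elsewhere. -/
theorem exists_mpBij_of_injOn [StandardBorelSpace X] [IsFiniteMeasure μ] {T : X → X}
    (hT : MeasurePreserving T μ μ) {C : Set X} (hC : MeasurableSet C) (hC0 : ∀ᵐ x ∂μ, x ∈ C)
    (hinj : Set.InjOn T C) :
    ∃ S : mpBij μ, (∀ x, (x ∈ C ∧ (S : Equiv.Perm X) x = T x) ∨ (S : Equiv.Perm X) x = x) ∧
      ∀ᵐ x ∂μ, (S : Equiv.Perm X) x = T x := by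
  classical
  have hsub : ∀ n, iterCore T C n ⊆ C := by
    intro n
    induction n with
    | zero => exact subset_rfl
    | succ n ih => exact Set.inter_subset_left.trans ih
  have hmeas : ∀ n, MeasurableSet (iterCore T C n) := by
    intro n
    induction n with
    | zero => exact hC
    | succ n ih =>
      exact ih.inter ((ih.image_of_measurable_injOn hT.measurable (hinj.mono (hsub n))).inter
        (hT.measurable ih))
  have hae : ∀ n, ∀ᵐ x ∂μ, x ∈ iterCore T C n := by
    intro n
    induction n with
    | zero => exact hC0
    | succ n ih =>
      have him : MeasurableSet (T '' iterCore T C n) :=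
        (hmeas n).image_of_measurable_injOn hT.measurable (hinj.mono (hsub n))
      have h1 : ∀ᵐ x ∂μ, x ∈ T '' iterCore T C n := by
        rw [← hT.map_eq]
        refine (ae_map_iff (p := (· ∈ T '' iterCore T C n)) hT.measurable.aemeasurable him).2 ?_
        filter_upwards [ih] with x hx using Set.mem_image_of_mem T hx
      filter_upwards [ih, h1, hT.quasiMeasurePreserving.ae ih] with x h1 h2 h3
      exact ⟨h1, h2, h3⟩
  -- `T` maps `K` bijectively onto itself, so `T` on `K` and the identity off `K` glue to a
  -- bijection of `X`.
  let K : Set X := ⋂ n, iterCore T C n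
  have hKm : MeasurableSet K := MeasurableSet.iInter hmeas
  have hKC : K ⊆ C := (Set.iInter_subset _ 0).trans (hsub 0)
  have hK : ∀ᵐ x ∂μ, x ∈ K := by
    filter_upwards [ae_all_iff.2 hae] with x hx using Set.mem_iInter.2 hx
  have hKT : ∀ x ∈ K, T x ∈ K := fun x hx =>
    Set.mem_iInter.2 fun n => (Set.mem_iInter.1 hx (n + 1)).2.2
  have hKS : ∀ x ∈ K, ∃ y ∈ K, T y = x := by
    intro x hx
    have h : ∀ n, ∃ y ∈ iterCore T C n, T y = x := fun n => (Set.mem_iInter.1 hx (n + 1)).2.1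
    choose y hy hyx using h
    -- The preimages of `x` found at the different levels coincide because `T` is injective on `C`.
    refine ⟨y 0, Set.mem_iInter.2 fun n => ?_, hyx 0⟩
    rw [hinj (hsub 0 (hy 0)) (hsub n (hy n)) ((hyx 0).trans (hyx n).symm)]
    exact hy n
  let F : X → X := K.piecewise T id
  have hF1 : ∀ x ∈ K, F x = T x := fun x hx => Set.piecewise_eq_of_mem _ _ _ hx
  have hF2 : ∀ x, x ∉ K → F x = x := fun x hx => Set.piecewise_eq_of_notMem _ _ _ hx
  have hFm : Measurable F := hT.measurable.piecewise hKm measurable_id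
  have hFK : ∀ x, F x ∈ K ↔ x ∈ K := by
    intro x
    by_cases hx : x ∈ K
    · simp only [hF1 x hx, hKT x hx, hx]
    · simp only [hF2 x hx]
  have hFinj : Function.Injective F := by
    intro x y hxy
    by_cases hx : x ∈ K
    · have hy : y ∈ K := (hFK y).1 (hxy ▸ (hFK x).2 hx)
      rw [hF1 x hx, hF1 y hy] at hxy
      exact hinj (hKC hx) (hKC hy) hxy
    · have hy : y ∉ K := fun hy => hx ((hFK x).1 (hxy ▸ (hFK y).2 hy))
      rwa [hF2 x hx, hF2 y hy] at hxy
  have hFsurj : Function.Surjective F := by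
    intro x
    by_cases hx : x ∈ K
    · obtain ⟨y, hy, hyx⟩ := hKS x hx
      exact ⟨y, (hF1 y hy).trans hyx⟩
    · exact ⟨x, hF2 x hx⟩
  have hFT : F =ᵐ[μ] T := by
    filter_upwards [hK] with x hx using hF1 x hx
  have hFmp : MeasurePreserving F μ μ :=
    ⟨hFm, by rw [Measure.map_congr hFT, hT.map_eq]⟩
  let e : Equiv.Perm X := Equiv.ofBijective F ⟨hFinj, hFsurj⟩
  have hem : MeasurableEmbedding F := hFm.measurableEmbedding hFinj
  have hinv : Measurable (e⁻¹ : Equiv.Perm X) := by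
    intro s hs
    have := hem.measurableSet_image.2 hs
    rw [show F = e from rfl, Equiv.image_eq_preimage_symm] at this
    exact this
  let M : X ≃ᵐ X := ⟨e, hFm, hinv⟩
  have hM : MeasurePreserving M μ μ := hFmp
  refine ⟨⟨e, hFmp, hM.symm⟩, fun x => ?_, hFT⟩
  by_cases hx : x ∈ K
  · exact Or.inl ⟨hKC hx, hF1 x hx⟩
  · exact Or.inr (hF2 x hx)

end Extension

/-! ### Pointwise descriptions of the two full groups. -/

section Action

variable {G X : Type*} [Group G] [MeasurableSpace X] [MulAction G X] {μ : Measure X}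

theorem ae_rep_mk (S : mpBij μ) :
    ∀ᵐ x ∂μ, ((Aut.mk μ S).rep : Equiv.Perm X) x = (S : Equiv.Perm X) x :=
  Aut.mk_eq_mk_iff.1 (Aut.mk_rep _)

theorem ae_rep_mul (S T : Aut μ) :
    ∀ᵐ x ∂μ, ((S * T).rep : Equiv.Perm X) x =
      (S.rep : Equiv.Perm X) ((T.rep : Equiv.Perm X) x) := by
  have h : Aut.mk μ (S * T).rep = Aut.mk μ (S.rep * T.rep) := by
    rw [map_mul, Aut.mk_rep, Aut.mk_rep, Aut.mk_rep]
  exact Aut.mk_eq_mk_iff.1 h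

theorem ae_rep_inv (T : Aut μ) :
    ∀ᵐ x ∂μ, (T⁻¹.rep : Equiv.Perm X) x = (T.rep : Equiv.Perm X)⁻¹ x := by
  have h : Aut.mk μ T⁻¹.rep = Aut.mk μ T.rep⁻¹ := by
    rw [map_inv, Aut.mk_rep, Aut.mk_rep]
  exact Aut.mk_eq_mk_iff.1 h

/-- The transformations that agree with countably many elements of `H`. -/
def pieceGroup (μ : Measure X) (H : Subgroup G) : Subgroup (Aut μ) where
  carrier := {T | ∃ h : ℕ → H, ∀ᵐ x ∂μ, ∃ n, (T.rep : Equiv.Perm X) x = (h n : G) • x}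
  one_mem' := by
    refine ⟨fun _ => 1, ?_⟩
    have h : ∀ᵐ x ∂μ, ((1 : Aut μ).rep : Equiv.Perm X) x = x := by
      simpa using ae_rep_mk (1 : mpBij μ)
    filter_upwards [h] with x hx
    exact ⟨0, by simpa using hx⟩
  mul_mem' := by
    rintro S T ⟨a, ha⟩ ⟨b, hb⟩
    refine ⟨fun n => a n.unpair.1 * b n.unpair.2, ?_⟩
    filter_upwards [ae_rep_mul S T, hb, T.rep.2.1.quasiMeasurePreserving.ae ha]
      with x h1 ⟨n, hn⟩ ⟨m, hm⟩
    refine ⟨Nat.pair m n, ?_⟩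
    rw [h1, hm, hn]
    simp [mul_smul]
  inv_mem' := by
    rintro T ⟨a, ha⟩
    refine ⟨fun n => (a n)⁻¹, ?_⟩
    filter_upwards [ae_rep_inv T, T.rep.2.2.quasiMeasurePreserving.ae ha] with x h1 ⟨n, hn⟩
    refine ⟨n, ?_⟩
    rw [h1]
    simp only [InvMemClass.coe_inv]
    rw [eq_inv_smul_iff, ← hn]
    simp

theorem isFull_pieceGroup (μ : Measure X) (H : Subgroup G) : IsFull (pieceGroup μ H) := by
  rintro t T ht ⟨A, -, -, hA, hT⟩
  choose a ha using ht
  refine ⟨fun n => a n.unpair.1 n.unpair.2, ?_⟩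
  filter_upwards [ae_all_iff.2 ha, ae_all_iff.2 hT] with x h1 h2
  obtain ⟨n, hn⟩ := Set.mem_iUnion.1 (hA ▸ Set.mem_univ x)
  obtain ⟨m, hm⟩ := h1 n
  exact ⟨Nat.pair n m, by simpa using (h2 n hn).trans hm⟩

/-- The definition constrains every point, but an almost everywhere condition suffices: a
representative can be replaced by the identity off a good set, and the identity stays in orbits. -/
theorem mem_orbitFullGroup_iff [StandardBorelSpace X] [IsFiniteMeasure μ] {H : Subgroup G}
    {T : Aut μ} :
    T ∈ orbitFullGroup μ H ↔ ∀ᵐ x ∂μ, ∃ h ∈ H, (T.rep : Equiv.Perm X) x = h • x := by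
  constructor
  · rintro ⟨S, hS, rfl⟩
    filter_upwards [ae_rep_mk S] with x hx
    obtain ⟨h, hh⟩ := (MulAction.orbitRel H X).symm (hS x)
    exact ⟨h, h.2, hx.trans hh.symm⟩
  · intro h
    obtain ⟨C, hC, hCm, hCs⟩ := h.exists_measurable_mem
    obtain ⟨S, hS, hST⟩ := exists_mpBij_of_injOn T.rep.2.1 hCm hC
      (T.rep : Equiv.Perm X).injective.injOn
    refine ⟨S, fun x => ?_, ?_⟩
    · obtain ⟨hx, hSx⟩ | hSx := hS x
      · obtain ⟨g, hg, hgx⟩ := hCs x hx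
        exact (MulAction.orbitRel H X).symm ⟨⟨g, hg⟩, (hSx.trans hgx).symm⟩
      · rw [hSx]
    · rw [← Aut.mk_rep T]
      exact Aut.mk_eq_mk_iff.2 hST

variable [MeasurableConstSMul G X] [SMulInvariantMeasure G X μ]

theorem ae_rep_actionHom (g : G) :
    ∀ᵐ x ∂μ, ((actionHom G μ g).rep : Equiv.Perm X) x = g • x :=
  ae_rep_mk _

theorem dyeFullGroupOf_eq_pieceGroup [StandardBorelSpace X] (H : Subgroup G) :
    dyeFullGroupOf μ H = pieceGroup μ H := by
  refine le_antisymm ((isLeast_dyeFullGroup _).2 ⟨isFull_pieceGroup μ H, ?_⟩) ?_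
  · rintro _ ⟨g, hg, rfl⟩
    refine ⟨fun _ => ⟨g, hg⟩, ?_⟩
    filter_upwards [ae_rep_actionHom (μ := μ) g] with x hx
    exact ⟨0, hx⟩
  · rintro T ⟨a, ha⟩
    have hle := (isLeast_dyeFullGroup (H.map (actionHom G μ)))
    let B : ℕ → Set X := fun n => {x | (T.rep : Equiv.Perm X) x = (a n : G) • x}
    have hB : ∀ n, MeasurableSet (B n) := fun n =>
      measurableSet_eq_fun T.rep.2.1.measurable (measurable_const_smul (a n : G))
    -- Index `0` holds the null set missed by every `B k`, which shifts the others by one; hence `a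
    -- (n - 1)` below, whose value at `n = 0` is irrelevant.
    let B' : ℕ → Set X := fun n => Nat.casesOn n (⋃ k, B k)ᶜ B
    have hB' : ∀ n, MeasurableSet (B' n) := by
      rintro (_ | n)
      · exact (MeasurableSet.iUnion hB).compl
      · exact hB n
    have hU : (⋃ n, B' n) = Set.univ := by
      refine Set.eq_univ_of_forall fun x => ?_
      by_cases hx : x ∈ ⋃ k, B k
      · obtain ⟨k, hk⟩ := Set.mem_iUnion.1 hx
        exact Set.mem_iUnion.2 ⟨k + 1, hk⟩
      · exact Set.mem_iUnion.2 ⟨0, hx⟩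
    refine hle.1.1 (fun n => actionHom G μ (a (n - 1))) T
      (fun n => hle.1.2 ⟨_, (a (n - 1)).2, rfl⟩)
      ⟨disjointed B', fun n => MeasurableSet.disjointed hB' n, disjoint_disjointed B',
        (iUnion_disjointed).trans hU, ?_⟩
    rintro (_ | n)
    · filter_upwards [ha] with x ⟨k, hk⟩ hx
      exact absurd (Set.mem_iUnion.2 ⟨k, hk⟩) (disjointed_subset B' 0 hx)
    · filter_upwards [ae_rep_actionHom (μ := μ) (a n : G)] with x hx hxn
      have h1 : x ∈ B n := disjointed_subset B' (n + 1) hxn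
      exact Eq.trans h1 hx.symm

end Action

/-! ### Real-valued codes in `L¹` and Borel conditions on them. -/

section Codes

open ProbabilityTheory

variable {X : Type*} [MeasurableSpace X] {μ : Measure X}

noncomputable instance : MeasurableSpace (Lp ℝ 1 μ) := borel _

theorem measurable_of_forall_eq {α β : Type*} [MeasurableSpace α] [MeasurableSpace β]
    {f g : α → β} (hf : Measurable f) (h : ∀ x, f x = g x) : Measurable g :=
  funext h ▸ hf

instance : BorelSpace (Lp ℝ 1 μ) := ⟨rfl⟩

instance [MeasurableSpace.CountablyGenerated X] [IsFiniteMeasure μ] :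
    StandardBorelSpace (Lp ℝ 1 μ) := by
  have _ : Fact ((1 : ENNReal) ≠ ⊤) := ⟨ENNReal.one_ne_top⟩
  infer_instance

theorem continuous_setIntegral_comp [IsFiniteMeasure μ] {h : ℝ → ℝ} {K : NNReal}
    (hh : LipschitzWith K h) (A : Set X) :
    Continuous fun φ : Lp ℝ 1 μ => ∫ x in A, h (φ x) ∂μ := by
  -- Composition acts on `L¹` only for Lipschitz maps vanishing at `0`; the constant `h 0` is added
  -- back under the integral.
  have h0 : LipschitzWith K fun t => h t - h 0 :=
    LipschitzWith.of_dist_le_mul fun x y => by simpa using hh.dist_le_mul x y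
  have h00 : h 0 - h 0 = 0 := sub_self _
  have hc := ((continuous_setIntegral (μ := μ) (E := ℝ) A).comp
    (h0.continuous_compLp (p := 1) h00)).add_const (∫ _ in A, h 0 ∂μ)
  refine hc.congr fun φ => ?_
  have h1 : ∀ᵐ x ∂(μ.restrict A), h0.compLp h00 φ x = h (φ x) - h 0 :=
    ae_restrict_of_ae (h0.coeFn_compLp h00 φ)
  have hi : Integrable (h0.compLp h00 φ) (μ.restrict A) := (L1.integrable_coeFn _).restrict
  change ∫ x in A, h0.compLp h00 φ x ∂μ + _ = _
  rw [← integral_add hi (integrable_const _)]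
  refine integral_congr_ae ?_
  filter_upwards [h1] with x hx
  rw [hx, sub_add_cancel]

/-- The indicator of `(a, ∞)` is the pointwise limit of the Lipschitz ramps `min (max (n (t - a)) 0)
1`, whose integrals depend continuously on `φ`. -/
theorem measurable_measure_inter_lt [IsFiniteMeasure μ] (A : Set X) (a : ℝ) : Measurable fun φ : Lp ℝ 1 μ => μ (A ∩ {x | a < φ x}) := by
  let h : ℕ → ℝ → ℝ := fun n t => min (max ((n : ℝ) * (t - a)) 0) 1
  have hL : ∀ n : ℕ, LipschitzWith n (h n) := fun n => by
    refine LipschitzWith.min_const (LipschitzWith.max_const ?_ 0) 1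
    refine LipschitzWith.of_dist_le_mul fun x y => ?_
    rw [Real.dist_eq, Real.dist_eq, ← mul_sub, sub_sub_sub_cancel_right, abs_mul]
    simp
  have hb : ∀ n t, ‖h n t‖ ≤ 1 := fun n t => by
    rw [Real.norm_eq_abs, abs_of_nonneg (le_min (le_max_right _ _) zero_le_one)]
    exact min_le_right _ _
  have hlim : ∀ t, Tendsto (fun n => h n t) atTop (𝓝 ((Set.Ioi a).indicator (1 : ℝ → ℝ) t)) := fun t => by
    by_cases ht : a < t
    · rw [Set.indicator_of_mem (Set.mem_Ioi.2 ht)]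
      refine tendsto_const_nhds.congr' ?_
      have := (tendsto_natCast_atTop_atTop (R := ℝ)).atTop_mul_const (sub_pos.2 ht)
      filter_upwards [this.eventually_ge_atTop 1] with n hn
      exact (min_eq_right (hn.trans (le_max_left _ _))).symm
    · rw [Set.indicator_of_notMem (by simpa using ht)]
      refine tendsto_const_nhds.congr fun n => ?_
      have : (n : ℝ) * (t - a) ≤ 0 :=
        mul_nonpos_of_nonneg_of_nonpos n.cast_nonneg (by linarith [not_lt.1 ht])
      simp [h, max_eq_right this]
  have hm : Measurable fun φ : Lp ℝ 1 μ => ∫ x in A, (Set.Ioi a).indicator (1 : ℝ → ℝ) (φ x) ∂μ := by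
    refine measurable_of_tendsto_metrizable
      (fun n => (continuous_setIntegral_comp (hL n) A).measurable)
      (tendsto_pi_nhds.2 fun φ => ?_)
    refine tendsto_integral_of_dominated_convergence (fun _ => 1) (fun n => ?_)
      (integrable_const _) (fun n => ae_of_all _ fun x => hb n _)
      (ae_of_all _ fun x => hlim _)
    exact ((hL n).continuous.measurable.comp
      (Lp.stronglyMeasurable φ).measurable).aestronglyMeasurable
  refine measurable_of_forall_eq hm.ennreal_ofReal fun φ => ?_
  have hs : MeasurableSet {x | a < φ x} :=
    measurableSet_lt measurable_const (Lp.stronglyMeasurable φ).measurable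
  have he : (fun x => (Set.Ioi a).indicator (1 : ℝ → ℝ) (φ x)) = {x | a < φ x}.indicator 1 := rfl
  rw [he, integral_indicator_one hs, measureReal_restrict_apply hs, Set.inter_comm]
  simp

theorem measurable_map_graph [IsProbabilityMeasure μ] :
    Measurable fun φ : Lp ℝ 1 μ => μ.map fun x => (x, φ x) := by
  have hφ : ∀ φ : Lp ℝ 1 μ, Measurable fun x => (x, φ x) := fun φ =>
    measurable_id.prodMk (Lp.stronglyMeasurable φ).measurable
  have _ : ∀ φ : Lp ℝ 1 μ, IsProbabilityMeasure (μ.map fun x => (x, φ x)) := fun φ =>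
    Measure.isProbabilityMeasure_map (hφ φ).aemeasurable
  have hspan : IsCountablySpanning (Set.range (Set.Ioi : ℝ → Set ℝ)) := by
    refine ⟨fun n => Set.Ioi (-(n : ℝ)), fun n => ⟨_, rfl⟩, Set.eq_univ_of_forall fun x => ?_⟩
    obtain ⟨n, hn⟩ := exists_nat_gt (-x)
    exact Set.mem_iUnion.2 ⟨n, neg_lt.1 hn⟩
  have hgen := generateFrom_eq_prod (MeasurableSpace.generateFrom_measurableSet (α := X))
    ((borel_eq_generateFrom_Ioi ℝ).symm.trans (BorelSpace.measurable_eq (α := ℝ)).symm)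
    isCountablySpanning_measurableSet hspan
  refine Measurable.measure_of_isPiSystem_of_isProbabilityMeasure hgen.symm
    (MeasurableSpace.isPiSystem_measurableSet.prod isPiSystem_Ioi) ?_
  rintro _ ⟨A, hA, _, ⟨a, rfl⟩, rfl⟩
  refine measurable_of_forall_eq (measurable_measure_inter_lt A a) fun φ => ?_
  rw [Measure.map_apply (hφ φ) (MeasurableSet.prod hA measurableSet_Ioi)]
  rfl

theorem measurable_measure_graph [IsProbabilityMeasure μ] {B : Set (X × ℝ)}
    (hB : MeasurableSet B) : Measurable fun φ : Lp ℝ 1 μ => μ {x | (x, φ x) ∈ B} := by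
  refine measurable_of_forall_eq ((Measure.measurable_coe hB).comp measurable_map_graph) fun φ => ?_
  exact Measure.map_apply (measurable_id.prodMk (Lp.stronglyMeasurable φ).measurable) hB

/-- The distribution of an integrable function, as a kernel. -/
noncomputable def lawKernel (μ : Measure X) [IsProbabilityMeasure μ] : Kernel (Lp ℝ 1 μ) ℝ where
  toFun φ := (μ.map fun x => (x, φ x)).map Prod.snd
  measurable' := (Measure.measurable_map _ measurable_snd).comp measurable_map_graph

theorem lawKernel_apply [IsProbabilityMeasure μ] (φ : Lp ℝ 1 μ) :
    lawKernel μ φ = μ.map φ :=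
  Measure.map_map measurable_snd (measurable_id.prodMk (Lp.stronglyMeasurable φ).measurable)

instance [IsProbabilityMeasure μ] : IsMarkovKernel (lawKernel μ) :=
  ⟨fun φ => by
    rw [lawKernel_apply]
    exact Measure.isProbabilityMeasure_map (Lp.stronglyMeasurable φ).measurable.aemeasurable⟩

/-- Being countably valued up to a null set means that the law is purely atomic, i.e. gives no mass
to its non-atoms. This removes the quantifier over sequences and leaves a condition measurable in
`φ`. -/
theorem countablyValued_iff [IsProbabilityMeasure μ] (φ : Lp ℝ 1 μ) :
    (∃ a : ℕ → ℝ, ∀ᵐ x ∂μ, ∃ n, φ x = a n) ↔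
      lawKernel μ φ {r | lawKernel μ φ {r} = 0} = 0 := by
  have hφ : Measurable φ := (Lp.stronglyMeasurable φ).measurable
  have hc : {r | 0 < lawKernel μ φ {r}}.Countable :=
    Measure.countable_meas_pos_of_disjoint_iUnion (fun r => measurableSet_singleton r)
      fun r s hrs => Set.disjoint_singleton.2 hrs
  have hcompl : {r | lawKernel μ φ {r} = 0} = {r | 0 < lawKernel μ φ {r}}ᶜ := by
    ext r; simp
  constructor
  · rintro ⟨a, ha⟩
    have h1 : lawKernel μ φ (Set.range a)ᶜ = 0 := by
      rw [lawKernel_apply, Measure.map_apply hφ (Set.countable_range a).measurableSet.compl]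
      filter_upwards [ha] with x ⟨n, hn⟩
      simpa using ⟨n, hn.symm⟩
    have h2 : lawKernel μ φ (⋃ n, {a n} ∩ {r | lawKernel μ φ {r} = 0}) = 0 := by
      refine measure_iUnion_null fun n => ?_
      by_cases hn : lawKernel μ φ {a n} = 0
      · exact measure_mono_null Set.inter_subset_left hn
      · exact measure_mono_null (fun r hr => hn (hr.1 ▸ hr.2)) measure_empty
    refine measure_mono_null (fun r hr => ?_) (measure_union_null h1 h2)
    by_cases hra : r ∈ Set.range a
    · obtain ⟨n, rfl⟩ := hra
      exact Or.inr (Set.mem_iUnion.2 ⟨n, rfl, hr⟩)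
    · exact Or.inl hra
  · intro h
    obtain ⟨a, ha⟩ := Set.countable_iff_exists_subset_range.1 hc
    refine ⟨a, ?_⟩
    rw [hcompl, lawKernel_apply, Measure.map_apply hφ (by
      rw [← lawKernel_apply]; exact hc.measurableSet.compl)] at h
    have h' : ∀ᵐ x ∂μ, x ∉ φ ⁻¹' {r | 0 < (μ.map φ) {r}}ᶜ := measure_eq_zero_iff_ae_notMem.1 h
    filter_upwards [h'] with x hx
    obtain ⟨n, hn⟩ := ha (by rw [lawKernel_apply]; exact not_not.1 hx)
    exact ⟨n, hn.symm⟩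

theorem measurableSet_countablyValued [IsProbabilityMeasure μ] :
    MeasurableSet {φ : Lp ℝ 1 μ | ∃ a : ℕ → ℝ, ∀ᵐ x ∂μ, ∃ n, φ x = a n} := by
  simp_rw [countablyValued_iff]
  have h1 : Measurable fun p : Lp ℝ 1 μ × ℝ => lawKernel μ p.1 {p.2} := by
    exact Kernel.measurable_kernel_prodMk_left
      (κ := (lawKernel μ).comap (Prod.fst : Lp ℝ 1 μ × ℝ → _) measurable_fst)
      (t := {q | q.2 = q.1.2})
      (measurableSet_eq_fun measurable_snd (measurable_snd.comp measurable_fst))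
  have h2 : MeasurableSet {p : Lp ℝ 1 μ × ℝ | lawKernel μ p.1 {p.2} = 0} :=
    h1 (measurableSet_singleton 0)
  exact (Kernel.measurable_kernel_prodMk_left (κ := lawKernel μ) h2) (measurableSet_singleton 0)

end Codes

/-! ### Cocycles, and decoding them into `Aut(X, μ)`. -/

section Decoding

variable {G X : Type*} [Group G] [MeasurableSpace G] [MeasurableSpace X] [MulAction G X]
  {μ : Measure X}

theorem mpBij.measure_image_symmDiff (T : mpBij μ) {A B : Set X} (hA : MeasurableSet A)
    (hB : MeasurableSet B) :
    μ (((T : Equiv.Perm X) '' A) ∆ B) = μ {x | ¬(x ∈ A ↔ (T : Equiv.Perm X) x ∈ B)} := by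
  have hTA : MeasurableSet ((T : Equiv.Perm X) '' A) := (mpBij.image T ⟨A, hA⟩).2
  rw [← T.2.1.measure_preimage (hTA.symmDiff hB).nullMeasurableSet]
  congr 1
  ext x
  simp only [Set.mem_preimage, Set.mem_symmDiff, Set.mem_ofPred_eq,
    (T : Equiv.Perm X).injective.mem_set_image]
  tauto

omit [MeasurableSpace G] in
theorem EssentiallyFree.ae_smul_inj (hfree : EssentiallyFree G μ) :
    ∀ᵐ x ∂μ, ∀ g h : G, g • x = h • x → g = h := by
  obtain ⟨A, hA0, -, hA⟩ := hfree
  have h0 : ∀ᵐ x ∂μ, x ∈ A := hA0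
  filter_upwards [h0] with x hx g h hgh
  by_contra hne
  refine hA (h⁻¹ * g) (fun h1 => hne (inv_mul_eq_one.1 h1).symm) x hx ?_
  rw [mul_smul, hgh, inv_smul_smul]

/-- Over a conull Borel set, the pairs `(x, g)` with `T x = g • x` form a Borel set that freeness
makes a graph. Its projection to `X` is injective, so by Lusin–Souslin it has a Borel inverse. `H`
itself may be arbitrary: the `g` found is forced to be the one in `H`. -/
theorem exists_measurable_cocycle [StandardBorelSpace G] [StandardBorelSpace X]
    [MeasurableSMul₂ G X] (hfree : EssentiallyFree G μ) {T : X → X} (hT : Measurable T)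
    {H : Subgroup G} (h : ∀ᵐ x ∂μ, ∃ g ∈ H, T x = g • x) :
    ∃ c : X → G, Measurable c ∧ ∀ᵐ x ∂μ, c x ∈ H ∧ T x = c x • x := by
  obtain ⟨A, hA, hAm, hAs⟩ := (h.and hfree.ae_smul_inj).exists_measurable_mem
  let Γ : Set (X × G) := {p | p.1 ∈ A ∧ T p.1 = p.2 • p.1}
  have hΓ : MeasurableSet Γ := (measurable_fst hAm).inter
    (measurableSet_eq_fun (hT.comp measurable_fst) (measurable_snd.smul measurable_fst))
  have _ : StandardBorelSpace Γ := hΓ.standardBorel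
  have hinj : Function.Injective fun p : Γ => p.1.1 := by
    rintro ⟨⟨x, g⟩, hx, hg⟩ ⟨⟨y, g'⟩, hy, hg'⟩ (rfl : x = y)
    have : g = g' := (hAs x hx).2 g g' (hg.symm.trans hg')
    subst this
    rfl
  have hemb := (measurable_fst.comp measurable_subtype_coe : Measurable fun p : Γ => p.1.1)
    |>.measurableEmbedding hinj
  obtain ⟨c, hc, hcΓ⟩ := hemb.exists_measurable_extend
    (measurable_snd.comp measurable_subtype_coe : Measurable fun p : Γ => p.1.2) fun _ => ⟨1⟩
  refine ⟨c, hc, ?_⟩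
  filter_upwards [hA] with x hx
  obtain ⟨g, hg, hgx⟩ := (hAs x hx).1
  have : c x = g := congrFun hcΓ ⟨(x, g), hx, hgx⟩
  rw [this]
  exact ⟨hg, hgx⟩

/-- The codes of transformations: those `φ` for which `x ↦ k (φ x) • x` preserves the measure and
generates a dense family of measurable sets. -/
def validCodes (μ : Measure X) (k : ℝ → G) (D : ℕ → Set X) : Set (Lp ℝ 1 μ) :=
  {φ | (∀ n, μ {x | k (φ x) • x ∈ D n} = μ (D n)) ∧
    ∀ n m : ℕ, ∃ l, μ {x | ¬(x ∈ D n ↔ k (φ x) • x ∈ D l)} < 2⁻¹ ^ m}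

variable [MeasurableSMul₂ G X] {k : ℝ → G} {D : ℕ → Set X}

theorem measurable_code_smul (hk : Measurable k) :
    Measurable fun p : X × ℝ => k p.2 • p.1 :=
  (hk.comp measurable_snd).smul measurable_fst

theorem measurableSet_not_iff {Ω : Type*} [MeasurableSpace Ω] {f g : Ω → X} (hf : Measurable f)
    (hg : Measurable g) {A B : Set X} (hA : MeasurableSet A) (hB : MeasurableSet B) :
    MeasurableSet {ω | ¬(f ω ∈ A ↔ g ω ∈ B)} :=
  MeasurableSet.compl (MeasurableSet.iff (hf hA) (hg hB))

variable [IsProbabilityMeasure μ]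

theorem measurable_measure_not_iff (hk : Measurable k) {A B : Set X} (hA : MeasurableSet A)
    (hB : MeasurableSet B) :
    Measurable fun φ : Lp ℝ 1 μ => μ {x | ¬(x ∈ A ↔ k (φ x) • x ∈ B)} :=
  measurable_measure_graph
    (measurableSet_not_iff measurable_fst (measurable_code_smul hk) hA hB)

theorem measurableSet_validCodes (hk : Measurable k) (hD : ∀ n, MeasurableSet (D n)) :
    MeasurableSet (validCodes μ k D) := by
  refine MeasurableSet.inter ?_ ?_
  · refine MeasurableSet.congr (MeasurableSet.iInter fun n =>
      measurable_measure_graph ((measurable_code_smul hk) (hD n))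
        (measurableSet_singleton (μ (D n)))) ?_
    ext φ
    simp only [Set.mem_iInter]
    exact Iff.rfl
  · refine MeasurableSet.congr (MeasurableSet.iInter fun n => MeasurableSet.iInter fun m : ℕ =>
      MeasurableSet.iUnion fun l => measurableSet_lt
        (measurable_measure_not_iff hk (hD n) (hD l)) (measurable_const (a := 2⁻¹ ^ m))) ?_
    ext φ
    simp only [Set.mem_iInter, Set.mem_iUnion]
    exact Iff.rfl

theorem exists_mpBij_of_mem_validCodes [StandardBorelSpace X] (hk : Measurable k)
    (hD : IsDenseSeq μ D) {φ : Lp ℝ 1 μ} (hφ : φ ∈ validCodes μ k D) :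
    ∃ S : mpBij μ, ∀ᵐ x ∂μ, (S : Equiv.Perm X) x = k (φ x) • x := by
  have hTm : Measurable fun x => k (φ x) • x :=
    (hk.comp (Lp.stronglyMeasurable φ).measurable).smul measurable_id
  have hT : MeasurePreserving (fun x => k (φ x) • x) μ μ := by
    refine ⟨hTm, ?_⟩
    have _ : IsProbabilityMeasure (μ.map fun x => k (φ x) • x) :=
      Measure.isProbabilityMeasure_map hTm.aemeasurable
    refine ext_of_generate_finite _ hD.generateFrom_eq.symm hD.isPiSystem ?_ (by simp)
    rintro _ ⟨n, rfl⟩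
    rw [Measure.map_apply hTm (hD.measurableSet n)]
    exact hφ.1 n
  choose l hl using hφ.2
  let E : ℕ → ℕ → Set X := fun n m => {x | ¬(x ∈ D n ↔ k (φ x) • x ∈ D (l n m))}
  -- Borel–Cantelli: the errors `2⁻¹ ^ m` are summable.
  have hae : ∀ᵐ x ∂μ, ∀ n, ∀ᶠ m in atTop, x ∉ E n m := by
    refine ae_all_iff.2 fun n => ae_eventually_notMem (ne_top_of_le_ne_top ?_
      (ENNReal.tsum_le_tsum fun m => (hl n m).le))
    rw [ENNReal.tsum_geometric]
    simp
  obtain ⟨C, hC, hCm, hCs⟩ := hae.exists_measurable_mem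
  have hinj : Set.InjOn (fun x => k (φ x) • x) C := by
    intro x hx y hy hxy
    refine hD.eq_of_forall fun n => ?_
    -- For large `m`, whether `x` or `y` lies in `D n` is decided by whether its image lies in `D (l
    -- n m)`, and the two images are equal.
    obtain ⟨m, hmx, hmy⟩ := ((hCs x hx n).and (hCs y hy n)).exists
    have h1 := not_not.1 hmx
    have h2 := not_not.1 hmy
    change k (φ x) • x = k (φ y) • y at hxy
    rw [h1, h2, hxy]
  obtain ⟨S, -, hS⟩ := exists_mpBij_of_injOn hT hCm hC hinj
  exact ⟨S, hS⟩

omit [MeasurableSpace G] [MeasurableSMul₂ G X] [IsProbabilityMeasure μ] in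
theorem mem_validCodes (hD : IsDenseSeq μ D) {φ : Lp ℝ 1 μ} (S : mpBij μ)
    (hS : ∀ᵐ x ∂μ, (S : Equiv.Perm X) x = k (φ x) • x) : φ ∈ validCodes μ k D := by
  refine ⟨fun n => ?_, fun n m => ?_⟩
  · rw [← S.2.1.measure_preimage (hD.measurableSet n).nullMeasurableSet]
    refine measure_congr (eventuallyEq_set.2 ?_)
    filter_upwards [hS] with x hx
    simp [hx]
  · obtain ⟨l, hl⟩ := hD.exists_lt _ (mpBij.image S ⟨D n, hD.measurableSet n⟩).2 (2⁻¹ ^ m)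
      (ENNReal.pow_pos (by simp) m)
    refine ⟨l, lt_of_le_of_lt (le_of_eq ?_) hl⟩
    refine Eq.trans ?_
      (mpBij.measure_image_symmDiff S (hD.measurableSet n) (hD.measurableSet l)).symm
    refine measure_congr (eventuallyEq_set.2 ?_)
    filter_upwards [hS] with x hx
    simp [hx]

/-- `Q` is the image of the standard Borel space `P` under decoding. Decoding is injective because
freeness recovers `k (φ x)` from the transformation, and `k` is injective on the range of `j`. -/
theorem measurableSet_of_codes [StandardBorelSpace X] (hfree : EssentiallyFree G μ)
    (hk : Measurable k) (hD : IsDenseSeq μ D) {j : G → ℝ} (hkj : ∀ g, k (j g) = g)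
    {P : Set (Lp ℝ 1 μ)} (hP : MeasurableSet P) (hPv : P ⊆ validCodes μ k D)
    (hPj : ∀ φ ∈ P, ∀ᵐ x ∂μ, φ x ∈ Set.range j) {Q : Set (Aut μ)}
    (hQ : ∀ T : Aut μ, T ∈ Q ↔ ∃ φ ∈ P, ∀ᵐ x ∂μ, (T.rep : Equiv.Perm X) x = k (φ x) • x) :
    MeasurableSet Q := by
  have hex : ∀ φ : P, ∃ T : Aut μ, ∀ᵐ x ∂μ,
      (T.rep : Equiv.Perm X) x = k ((φ : Lp ℝ 1 μ) x) • x := fun φ => by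
    obtain ⟨S, hS⟩ := exists_mpBij_of_mem_validCodes hk hD (hPv φ.2)
    refine ⟨Aut.mk μ S, ?_⟩
    filter_upwards [ae_rep_mk S, hS] with x h1 h2 using h1.trans h2
  choose f hf using hex
  have hfm : Measurable f := by
    refine measurable_aut fun A B hA hB => ?_
    refine measurable_of_forall_eq
      ((measurable_measure_not_iff hk hA hB).comp measurable_subtype_coe) fun φ => ?_
    rw [mpBij.measure_image_symmDiff _ hA hB]
    refine measure_congr (eventuallyEq_set.2 ?_)
    filter_upwards [hf φ] with x hx
    simp [hx]
  have hfi : Function.Injective f := by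
    intro φ ψ h
    have h1 := hf φ
    rw [h] at h1
    refine Subtype.ext (Lp.ext ?_)
    filter_upwards [h1, hf ψ, hfree.ae_smul_inj, hPj φ φ.2, hPj ψ ψ.2]
      with x h1 h2 h3 ⟨g, hg⟩ ⟨g', hg'⟩
    have := h3 _ _ (h1.symm.trans h2)
    rw [← hg, ← hg', hkj, hkj] at this
    rw [← hg, ← hg', this]
  have _ : StandardBorelSpace P := hP.standardBorel
  have hr : Q = Set.range f := by
    ext T
    rw [hQ]
    constructor
    · rintro ⟨φ, hφ, hT⟩
      refine ⟨⟨φ, hφ⟩, ?_⟩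
      rw [← Aut.mk_rep T, ← Aut.mk_rep (f ⟨φ, hφ⟩), Aut.mk_eq_mk_iff]
      filter_upwards [hf ⟨φ, hφ⟩, hT] with x h1 h2 using h1.trans h2.symm
    · rintro ⟨φ, rfl⟩
      exact ⟨φ, φ.2, hf φ⟩
  rw [hr]
  exact (hfm.measurableEmbedding hfi).measurableSet_range

end Decoding

/-! ### Transfer of Borelness between `H` and its full groups. -/

section BorelSubgroups

variable {G X : Type*} [Group G] [MeasurableSpace G] [MeasurableSpace X] [MulAction G X]
  {μ : Measure X}

theorem exists_bounded_measurableEmbedding (G : Type*) [MeasurableSpace G] [StandardBorelSpace G]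
    [Nonempty G] : ∃ (j : G → ℝ) (k : ℝ → G) (C : ℝ), MeasurableEmbedding j ∧ Measurable k ∧
      (∀ g, ‖j g‖ ≤ C) ∧ ∀ g, k (j g) = g := by
  -- The arctangent makes the embedding bounded, so that every coded cocycle is integrable.
  have hj : MeasurableEmbedding (Real.arctan ∘ embeddingReal G) :=
    (Real.continuous_arctan.measurable.measurableEmbedding Real.arctan_injective).comp
      (measurableEmbedding_embeddingReal G)
  obtain ⟨k, hk, hkj⟩ := hj.exists_measurable_extend measurable_id fun _ => ‹Nonempty G›
  refine ⟨_, k, Real.pi / 2, hj, hk, fun g => ?_, congrFun hkj⟩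
  exact abs_le.2 ⟨(Real.neg_pi_div_two_lt_arctan _).le, (Real.arctan_lt_pi_div_two _).le⟩

omit [MeasurableSpace G] in
theorem mem_orbitFullGroup_of_mem_pieceGroup [StandardBorelSpace X] [IsFiniteMeasure μ]
    {H : Subgroup G} {T : Aut μ} (hT : T ∈ pieceGroup μ H) : T ∈ orbitFullGroup μ H := by
  obtain ⟨a, ha⟩ := hT
  rw [mem_orbitFullGroup_iff]
  filter_upwards [ha] with x ⟨n, hn⟩ using ⟨a n, (a n).2, hn⟩

variable [StandardBorelSpace G] [StandardBorelSpace X] [MeasurableSMul₂ G X]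
  [IsProbabilityMeasure μ]

theorem exists_code {j : G → ℝ} {k : ℝ → G} {C : ℝ} (hj : Measurable j)
    (hjC : ∀ g, ‖j g‖ ≤ C) (hkj : ∀ g, k (j g) = g) (hfree : EssentiallyFree G μ)
    {H : Subgroup G} {T : Aut μ} (hT : T ∈ orbitFullGroup μ H) :
    ∃ φ : Lp ℝ 1 μ, (∀ᵐ x ∂μ, φ x ∈ j '' H) ∧
      ∀ᵐ x ∂μ, (T.rep : Equiv.Perm X) x = k (φ x) • x := by
  obtain ⟨c, hc, hcT⟩ := exists_measurable_cocycle hfree T.rep.2.1.measurable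
    (mem_orbitFullGroup_iff.1 hT)
  have hm : MemLp (fun x => j (c x)) 1 μ :=
    MemLp.of_bound (hj.comp hc).aestronglyMeasurable C (ae_of_all _ fun x => hjC _)
  refine ⟨hm.toLp _, ?_, ?_⟩
  · filter_upwards [hm.coeFn_toLp, hcT] with x h1 h2
    rw [h1]
    exact Set.mem_image_of_mem j h2.1
  · filter_upwards [hm.coeFn_toLp, hcT] with x h1 h2
    rw [h1, hkj]
    exact h2.2

theorem measurableSet_fullGroups (hfree : EssentiallyFree G μ) {H : Subgroup G}
    (hH : MeasurableSet (H : Set G)) :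
    MeasurableSet (orbitFullGroup μ H : Set (Aut μ)) ∧
      MeasurableSet (pieceGroup μ H : Set (Aut μ)) := by
  obtain ⟨j, k, C, hj, hk, hjC, hkj⟩ := exists_bounded_measurableEmbedding G
  obtain ⟨D, hD⟩ := exists_isDenseSeq μ
  have hjH : MeasurableSet (j '' (H : Set G)) := hj.measurableSet_image.2 hH
  let P : Set (Lp ℝ 1 μ) := validCodes μ k D ∩ {φ | ∀ᵐ x ∂μ, φ x ∈ j '' (H : Set G)}
  have hP : MeasurableSet P := by
    refine (measurableSet_validCodes hk hD.measurableSet).inter ?_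
    exact measurable_measure_graph (measurable_snd hjH.compl) (measurableSet_singleton 0)
  have hPj : ∀ φ ∈ P, ∀ᵐ x ∂μ, φ x ∈ Set.range j := fun φ hφ => by
    filter_upwards [hφ.2] with x hx using Set.image_subset_range _ _ hx
  have hcode : ∀ T ∈ orbitFullGroup μ H, ∃ φ ∈ P,
      ∀ᵐ x ∂μ, (T.rep : Equiv.Perm X) x = k (φ x) • x := fun T hT => by
    obtain ⟨φ, hφ, hφT⟩ := exists_code hj.measurable hjC hkj hfree hT
    exact ⟨φ, ⟨mem_validCodes hD _ hφT, hφ⟩, hφT⟩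
  constructor
  · refine measurableSet_of_codes hfree hk hD hkj hP Set.inter_subset_left hPj
      fun T => ⟨hcode T, ?_⟩
    rintro ⟨φ, hφ, hT⟩
    refine mem_orbitFullGroup_iff.2 ?_
    filter_upwards [hφ.2, hT] with x ⟨g, hg, hgx⟩ h2
    refine ⟨g, hg, ?_⟩
    rw [h2, ← hgx, hkj]
  · refine measurableSet_of_codes hfree hk hD hkj (hP.inter measurableSet_countablyValued)
      (Set.inter_subset_left.trans Set.inter_subset_left) (fun φ hφ => hPj φ hφ.1)
      fun T => ⟨fun hT => ?_, ?_⟩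
    · obtain ⟨φ, hφ, hφT⟩ := hcode T (mem_orbitFullGroup_of_mem_pieceGroup hT)
      obtain ⟨a, ha⟩ := hT
      refine ⟨φ, ⟨hφ, fun n => j (a n), ?_⟩, hφT⟩
      filter_upwards [ha, hφT, hPj φ hφ, hfree.ae_smul_inj] with x ⟨n, hn⟩ h2 ⟨g, hg⟩ h4
      have := h4 _ _ (h2.symm.trans hn)
      rw [← hg, hkj] at this
      exact ⟨n, by rw [← hg, this]⟩
    · rintro ⟨φ, ⟨hφ, a, ha⟩, hφT⟩
      classical
      -- Values of `a` that decode outside `H` are attained only on a null set, so the default `1`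
      -- does no harm.
      refine ⟨fun n => if h : k (a n) ∈ H then ⟨k (a n), h⟩ else 1, ?_⟩
      filter_upwards [ha, hφT, hφ.2] with x ⟨n, hn⟩ h2 ⟨g, hg, hgx⟩
      have hkn : k (a n) ∈ H := by rwa [← hn, ← hgx, hkj]
      exact ⟨n, by rw [h2, hn, dif_pos hkn]⟩

variable [SMulInvariantMeasure G X μ]

omit [StandardBorelSpace G] in
theorem measurable_actionHom : Measurable (actionHom G μ) := by
  refine measurable_aut fun A B hA hB => ?_
  refine measurable_of_forall_eq (measurable_measure_prodMk_left (ν := μ)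
    (measurableSet_not_iff (measurable_snd (α := G)) (measurable_fst.smul measurable_snd) hA hB))
    fun g => ?_
  rw [mpBij.measure_image_symmDiff _ hA hB]
  refine measure_congr (eventuallyEq_set.2 ?_)
  filter_upwards [ae_rep_actionHom (μ := μ) g] with x hx
  simp [hx]

omit [StandardBorelSpace G] in
-- A single generic point suffices: there `g • x = h • x` with `h ∈ H`, and freeness gives `g = h`.
theorem mem_of_actionHom_mem_orbitFullGroup (hfree : EssentiallyFree G μ) {H : Subgroup G}
    {g : G} (hg : actionHom G μ g ∈ orbitFullGroup μ H) : g ∈ H := by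
  obtain ⟨x, ⟨h, hH, hx⟩, hgx, hinj⟩ := ((mem_orbitFullGroup_iff.1 hg).and
    ((ae_rep_actionHom (μ := μ) g).and hfree.ae_smul_inj)).exists
  rwa [hinj g h (hgx.symm.trans hx)]

omit [StandardBorelSpace G] [StandardBorelSpace X]
  [IsProbabilityMeasure μ] in
theorem actionHom_mem_pieceGroup {H : Subgroup G} {g : G} (hg : g ∈ H) :
    actionHom G μ g ∈ pieceGroup μ H := by
  refine ⟨fun _ => ⟨g, hg⟩, ?_⟩
  filter_upwards [ae_rep_actionHom (μ := μ) g] with x hx using ⟨0, hx⟩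

end BorelSubgroups

end FullGroups

theorem theorem4p12 {G : Type*} {X : Type*}
    [Group G] [TopologicalSpace G] [IsTopologicalGroup G] [PolishSpace G]
    [MeasurableSpace G] [BorelSpace G]
    [MeasurableSpace X] [StandardBorelSpace X]
    (μ : MeasureTheory.Measure X) [MeasureTheory.IsProbabilityMeasure μ]
    [MeasureTheory.NullSingletonClass μ]
    [MulAction G X] [MeasurableSMul₂ G X] [MeasureTheory.SMulInvariantMeasure G X μ]
    (hfree : FullGroups.EssentiallyFree G μ) (H : Subgroup G) :
    List.TFAE
      [MeasurableSet (H : Set G),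
        MeasurableSet (FullGroups.dyeFullGroupOf μ H : Set (FullGroups.Aut μ)),
        MeasurableSet (FullGroups.orbitFullGroup μ H : Set (FullGroups.Aut μ))] := by
  rw [FullGroups.dyeFullGroupOf_eq_pieceGroup]
  -- Any such `K` pulls back to exactly `H` along the Borel map `actionHom G μ`; the two full groups
  -- are the extreme cases.
  have hpre : ∀ K : Subgroup (FullGroups.Aut μ), FullGroups.pieceGroup μ H ≤ K →
      K ≤ FullGroups.orbitFullGroup μ H → MeasurableSet (K : Set (FullGroups.Aut μ)) →
      MeasurableSet (H : Set G) := by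
    intro K h1 h2 hK
    refine (FullGroups.measurable_actionHom hK).congr (Set.ext fun g => ⟨fun hg => ?_, fun hg => ?_⟩)
    · exact FullGroups.mem_of_actionHom_mem_orbitFullGroup hfree (h2 hg)
    · exact h1 (FullGroups.actionHom_mem_pieceGroup hg)
  have hle : FullGroups.pieceGroup μ H ≤ FullGroups.orbitFullGroup μ H :=
    fun T hT => FullGroups.mem_orbitFullGroup_of_mem_pieceGroup hT
  tfae_have 1 → 2 := fun h => (FullGroups.measurableSet_fullGroups hfree h).2
  tfae_have 1 → 3 := fun h => (FullGroups.measurableSet_fullGroups hfree h).1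
  tfae_have 2 → 1 := hpre _ le_rfl hle
  tfae_have 3 → 1 := hpre _ hle le_rfl
  tfae_finish
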